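/- Let $\mathcal{G}$ be the group of polynomial automorphisms of the complex affine plane; each $\theta\in\mathcal{G}$ is identified with its pair of components in $\mathbb{C}[X,Y]^2$, and its degree $\deg\theta$ is the larger of the degrees of the two components. Let $\mathcal{A}\subset\mathcal{G}$ be the subgroup of affine automorphisms (those of degree one) and $\mathcal{B}\subset\mathcal{G}$ the subgroup of triangular automorphisms $(aX+P(Y),\,bY+c)$ with $a,b\in\mathbb{C}^*$, $c\in\mathbb{C}$, $P\in\mathbb{C}[Y]$. For a finite sequence $(d_1,\dots,d_k)$ let $\mathcal{G}_{(d_1,\dots,d_k)}$ be the set of automorphisms of polydegree $(d_1,\dots,d_k)$, that is, of all compositions $$\theta=\alpha_0\tau_1\alpha_1\cdots\tau_k\alpha_k$$ with $\alpha_0,\dots,\alpha_k\in\mathcal{A}$, $\alpha_i\notin\mathcal{B}$ for $1\le i\le k-1$, and $\tau_i\in\mathcal{B}\setminus\mathcal{A}$ with $\deg\tau_i=d_i$ for $1\le i\le k$. Equip $\mathcal{G}$ with the Zariski topology of its ind-variety structure: a subset $F\subset\mathcal{G}$ is closed if and only if, for every $n$, the set $\{\theta\in F:\deg\theta\le n\}$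 is the intersection of $\{\theta\in\mathcal{G}:\deg\theta\le n\}$ with the zero set of a family of polynomials in the coefficients of the components. Bars denote closures in $\mathcal{G}$ for this topology. Write $(2)^{m}$ for the sequence $(2,\dots,2)$ of length $m$, and $H_d=\{(X,\,Y+aX^d) : a\in\mathbb{C}\}$. **Theorem.** For every integer $d\ge 2$, $$\mathcal{G}_{(d)}\subset\overline{\mathcal{G}_{(2)^{d-1}}}.$$ In particular, $H_d\subset\overline{\mathcal{G}_{(2)^{d-1}}}$. -/

import Mathlib

noncomputable section

/-- The group `𝒢(K)` of automorphisms of the affine plane over `K`. An automorphism of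
`Spec K[X, Y]` is the same as an algebra automorphism of `K[X, Y]` (its comorphism); passing to
comorphisms reverses composition, so the group of automorphisms of the plane, with composition of
maps as multiplication, is the opposite of the group of algebra automorphisms. -/
def PlaneAut (K : Type*) [Field K] : Type _ :=
  (MvPolynomial (Fin 2) K ≃ₐ[K] MvPolynomial (Fin 2) K)ᵐᵒᵖ

namespace PlaneAut

instance (K : Type*) [Field K] : Group (PlaneAut K) :=
  inferInstanceAs (Group (MvPolynomial (Fin 2) K ≃ₐ[K] MvPolynomial (Fin 2) K)ᵐᵒᵖ)

/-- The components of a plane automorphism: `θ = (θ.component 0, θ.component 1)`, with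
`X = MvPolynomial.X 0` and `Y = MvPolynomial.X 1`. -/
def component {K : Type*} [Field K] (θ : PlaneAut K) (i : Fin 2) : MvPolynomial (Fin 2) K :=
  (MulOpposite.unop θ : MvPolynomial (Fin 2) K ≃ₐ[K] MvPolynomial (Fin 2) K) (MvPolynomial.X i)

/-- Multiplication is composition of maps: the components of `θ * η` are obtained by substituting
the components of `η` into those of `θ`. -/
theorem component_mul {K : Type*} [Field K] (θ η : PlaneAut K) (i : Fin 2) :
    (θ * η).component i = MvPolynomial.aeval η.component (θ.component i) := by
  have h : (MvPolynomial.aeval η.component : MvPolynomial (Fin 2) K →ₐ[K] _) =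
      ((MulOpposite.unop η : MvPolynomial (Fin 2) K ≃ₐ[K] MvPolynomial (Fin 2) K) :
        MvPolynomial (Fin 2) K →ₐ[K] MvPolynomial (Fin 2) K) := by
    ext j
    simp [component]
  rw [h]
  rfl

/-- The degree of a plane automorphism: the maximum of the degrees of its two components. -/
def degree {K : Type*} [Field K] (θ : PlaneAut K) : ℕ :=
  max (θ.component 0).totalDegree (θ.component 1).totalDegree

/-- The affine automorphisms `𝒜(K)`, those of degree one (no automorphism has degree zero). -/
def affineSet (K : Type*) [Field K] : Set (PlaneAut K) :=
  {θ | θ.degree ≤ 1}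

/-- The triangular automorphisms `ℬ(K)`, those of the form `(a X + P(Y), b Y + c)` with
`a, b` nonzero. -/
def triangularSet (K : Type*) [Field K] : Set (PlaneAut K) :=
  {θ | ∃ (a b c : K) (P : Polynomial K), a ≠ 0 ∧ b ≠ 0 ∧
    θ.component 0 =
      MvPolynomial.C a * MvPolynomial.X 0 + Polynomial.aeval (MvPolynomial.X 1) P ∧
    θ.component 1 = MvPolynomial.C b * MvPolynomial.X 1 + MvPolynomial.C c}

/-- The stratum `𝒢_{(d₁, …, d_k)}(K)` of automorphisms of polydegree `(d₁, …, d_k)`: those with a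
reduced factorization `α₀ τ₁ α₁ ⋯ τ_k α_k` in the amalgamated product, where each `α_i` is affine,
each `τ_i` is triangular and not affine, of degree `d_i`, and the inner factors
`α₁, …, α_{k-1}` are not triangular. -/
def polydegreeStratum (K : Type*) [Field K] (ds : List ℕ) : Set (PlaneAut K) :=
  {θ | ∃ (α : Fin (ds.length + 1) → PlaneAut K) (τ : Fin ds.length → PlaneAut K),
    (∀ i, α i ∈ affineSet K) ∧
    (∀ i, τ i ∈ triangularSet K \ affineSet K) ∧
    (∀ i, (τ i).degree = ds.get i) ∧
    (∀ i, i ≠ 0 → i ≠ Fin.last ds.length → α i ∉ triangularSet K) ∧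
    θ = α 0 * (List.ofFn fun i : Fin ds.length => τ i * α i.succ).prod}

/-- The set `H_d` of all automorphisms `(X, Y + a X ^ d)` with `a ∈ K`. -/
def rootSubgroupH (K : Type*) [Field K] (d : ℕ) : Set (PlaneAut K) :=
  {θ | ∃ a : K, θ.component 0 = MvPolynomial.X 0 ∧
    θ.component 1 = MvPolynomial.X 1 + MvPolynomial.C a * MvPolynomial.X 0 ^ d}

/-- The family of all coefficients of the two components. -/
def coeffs {K : Type*} [Field K] (θ : PlaneAut K) : Fin 2 × (Fin 2 →₀ ℕ) → K :=
  fun p => (θ.component p.1).coeff p.2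

/-- A set of automorphisms is closed in the ind-variety `𝒢(K)` if, for every `n`, its intersection
with the set of automorphisms of degree at most `n` is cut out there by polynomial equations in the
(finitely many possibly nonzero) coefficients, that is, it is closed in the Zariski topology
induced by the finite-dimensional affine space of pairs of polynomials of degree at most `n`. -/
def IsIndClosed {K : Type*} [Field K] (F : Set (PlaneAut K)) : Prop :=
  ∀ n : ℕ, ∃ S : Set (MvPolynomial (Fin 2 × (Fin 2 →₀ ℕ)) K),
    ∀ θ : PlaneAut K, θ.degree ≤ n → (θ ∈ F ↔ ∀ p ∈ S, MvPolynomial.eval θ.coeffs p = 0)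

/-- The Zariski topology of the ind-variety `𝒢(K)`. -/
instance zariskiTopology (K : Type*) [Field K] : TopologicalSpace (PlaneAut K) :=
  TopologicalSpace.ofClosed {F | IsIndClosed F}
    (fun _ => ⟨{1}, by simp⟩)
    (by
      intro A hA n
      choose! S hS using fun F (hF : F ∈ A) => hA hF n
      refine ⟨⋃ F ∈ A, S F, fun θ hθ => ?_⟩
      simp only [Set.mem_sInter, Set.mem_iUnion]
      constructor
      · rintro h p ⟨F, hF, hp⟩
        exact (hS F hF θ hθ).1 (h F hF) p hp
      · intro h F hF
        exact (hS F hF θ hθ).2 fun p hp => h p ⟨F, hF, hp⟩)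
    (by
      intro F hF G hG n
      obtain ⟨S, hS⟩ := hF n
      obtain ⟨T, hT⟩ := hG n
      refine ⟨Set.image2 (· * ·) S T, fun θ hθ => ?_⟩
      rw [Set.mem_union, hS θ hθ, hT θ hθ]
      constructor
      · rintro (h | h) _ ⟨p, hp, q, hq, rfl⟩
        · simp [h p hp]
        · simp [h q hq]
      · intro h
        by_contra! hne
        obtain ⟨⟨p, hp, hp0⟩, ⟨q, hq, hq0⟩⟩ := hne
        have := h (p * q) ⟨p, hp, q, hq, rfl⟩
        rw [map_mul] at this
        exact (mul_ne_zero hp0 hq0) this)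

/-- The closed sets of the Zariski topology are the ones described by `IsIndClosed`. -/
theorem isClosed_iff {K : Type*} [Field K] (F : Set (PlaneAut K)) :
    IsClosed F ↔ IsIndClosed F := by
  rw [← isOpen_compl_iff]
  change Fᶜᶜ ∈ {F | IsIndClosed F} ↔ _
  rw [compl_compl]
  rfl

end PlaneAut

end

noncomputable section

namespace PlaneAut

open MvPolynomial

/-! ### Automorphisms built from explicit components. -/

section Components

variable {K : Type*} [Field K]

/-! The proof is by induction on the degree: a triangular map of degree `m + 1` is a limit of
products of a quadratic triangular map, a linear shear and a triangular map of degree `m`. For `s ≠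
0`, compose `(X - s^(1-m) Y^2, Y)`, `(X, Y + s^m X)` and `(X + Q_s(Y), Y)`, where `Q_s = s^(-m) (Y
V(sY) - Y) + T(Y)`. With `W = Y V(sY)` and `A = X + T(Y)`, the second component is `W + s^m A`. The
negative powers of `s` in the first component collect into `s^(-m) (W - Y - s W^2)`. This has no
pole at `s = 0` if `V = 1 + z V^2` modulo `z^m`, which forces `V` to be the truncated Catalan
series; the remainder contributes `-Y^(m+1) E(sY)` with `E(0) = C_m`. Hence the limit at `s = 0` is
`(X + T(Y) - C_m Y^(m+1), Y)`. Since `C_m ≠ 0` in characteristic zero, rescaling by affine maps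
gives every triangular map of degree `m + 1`. For almost all `s`, `Q_s` has degree `m`, so the
induction hypothesis applies to the last two factors. Two tools finish the argument: a polynomial
one-parameter family with infinitely many members in a closed set lies in it
(`mem_of_infinite_family`), and prepending a triangular factor is compatible with closures
(`mul_mul_mem_closure_polydegreeStratum`). -/

theorem ext_component {θ η : PlaneAut K} (h : ∀ i, θ.component i = η.component i) : θ = η := by
  apply MulOpposite.unop_injective
  have h' : ((MulOpposite.unop θ : MvPolynomial (Fin 2) K ≃ₐ[K] MvPolynomial (Fin 2) K) :
      MvPolynomial (Fin 2) K →ₐ[K] MvPolynomial (Fin 2) K) =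
      ((MulOpposite.unop η : MvPolynomial (Fin 2) K ≃ₐ[K] MvPolynomial (Fin 2) K) :
        MvPolynomial (Fin 2) K →ₐ[K] MvPolynomial (Fin 2) K) :=
    MvPolynomial.algHom_ext h
  exact AlgEquiv.ext fun p => DFunLike.congr_fun h' p

@[simp]
theorem component_one (i : Fin 2) : (1 : PlaneAut K).component i = X i := rfl

/-- The automorphism with components `f`, whose inverse has components `g`. -/
def ofComponents (f g : Fin 2 → MvPolynomial (Fin 2) K) (hfg : ∀ i, aeval f (g i) = X i)
    (hgf : ∀ i, aeval g (f i) = X i) : PlaneAut K :=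
  MulOpposite.op (AlgEquiv.ofAlgHom (aeval f) (aeval g)
    (MvPolynomial.algHom_ext fun i => by simpa using hfg i)
    (MvPolynomial.algHom_ext fun i => by simpa using hgf i))

@[simp]
theorem component_ofComponents (f g : Fin 2 → MvPolynomial (Fin 2) K)
    (hfg : ∀ i, aeval f (g i) = X i) (hgf : ∀ i, aeval g (f i) = X i) (i : Fin 2) :
    (ofComponents f g hfg hgf).component i = f i :=
  MvPolynomial.aeval_X f i

/-- The triangular automorphism `(a X + P(Y), b Y + c)`. -/
def triangular (a b c : K) (P : Polynomial K) (ha : a ≠ 0) (hb : b ≠ 0) : PlaneAut K :=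
  ofComponents ![C a * X 0 + Polynomial.aeval (X 1) P, C b * X 1 + C c]
    ![C a⁻¹ * (X 0 - Polynomial.aeval (C b⁻¹ * (X 1 - C c)) P), C b⁻¹ * (X 1 - C c)]
    (by
      have hb' : (C b⁻¹ * C b : MvPolynomial (Fin 2) K) = 1 := by
        rw [← C_mul, inv_mul_cancel₀ hb, C_1]
      have ha' : (C a⁻¹ * C a : MvPolynomial (Fin 2) K) = 1 := by
        rw [← C_mul, inv_mul_cancel₀ ha, C_1]
      have hY : (C b⁻¹ * (C b * X 1) : MvPolynomial (Fin 2) K) = X 1 := by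
        linear_combination X 1 * hb'
      intro i
      fin_cases i
      · simp [← Polynomial.aeval_algHom_apply, algebraMap_eq, hY]
        linear_combination X 0 * ha'
      · simpa [algebraMap_eq] using hY)
    (by
      have hb' : (C b * C b⁻¹ : MvPolynomial (Fin 2) K) = 1 := by
        rw [← C_mul, mul_inv_cancel₀ hb, C_1]
      have ha' : (C a * C a⁻¹ : MvPolynomial (Fin 2) K) = 1 := by
        rw [← C_mul, mul_inv_cancel₀ ha, C_1]
      intro i
      fin_cases i
      · simp [← Polynomial.aeval_algHom_apply, algebraMap_eq]
        linear_combination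
          (X 0 - Polynomial.aeval (C b⁻¹ * (X 1 - C c) : MvPolynomial (Fin 2) K) P) * ha'
      · simp [algebraMap_eq]
        linear_combination (X 1 - C c) * hb')

section Triangular

variable (a b c : K) (P : Polynomial K) (ha : a ≠ 0) (hb : b ≠ 0)

@[simp]
theorem component_zero_triangular : (triangular a b c P ha hb).component 0 =
    C a * X 0 + Polynomial.aeval (X 1) P := by
  simp [triangular]

@[simp]
theorem component_one_triangular : (triangular a b c P ha hb).component 1 =
    C b * X 1 + C c := by
  simp [triangular]

theorem triangular_mem_triangularSet : triangular a b c P ha hb ∈ triangularSet K :=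
  ⟨a, b, c, P, ha, hb, by simp, by simp⟩

end Triangular

/-- The linear automorphism `(X, Y + s X)`. -/
def shear (s : K) : PlaneAut K :=
  ofComponents ![X 0, X 1 + C s * X 0] ![X 0, X 1 - C s * X 0]
    (by intro i; fin_cases i <;> simp [algebraMap_eq])
    (by intro i; fin_cases i <;> simp [algebraMap_eq])

@[simp]
theorem component_zero_shear (s : K) : (shear s).component 0 = X 0 := by
  simp [shear]

@[simp]
theorem component_one_shear (s : K) : (shear s).component 1 = X 1 + C s * X 0 := by
  simp [shear]

/-- The linear automorphism `(Y, X)`. -/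
def swap (K : Type*) [Field K] : PlaneAut K :=
  ofComponents ![X 1, X 0] ![X 1, X 0]
    (by intro i; fin_cases i <;> simp) (by intro i; fin_cases i <;> simp)

@[simp]
theorem component_zero_swap : (swap K).component 0 = X 1 := by
  simp [swap]

@[simp]
theorem component_one_swap : (swap K).component 1 = X 0 := by
  simp [swap]

end Components

/-! ### Degrees, and tests for being affine or triangular. -/

section Degree

variable {K : Type*} [Field K]

theorem totalDegree_component_le (θ : PlaneAut K) (i : Fin 2) :
    (θ.component i).totalDegree ≤ θ.degree := by
  fin_cases i
  · exact le_max_left _ _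
  · exact le_max_right _ _

theorem degree_le_iff {θ : PlaneAut K} {n : ℕ} :
    θ.degree ≤ n ↔ ∀ i, (θ.component i).totalDegree ≤ n := by
  simp [degree, Fin.forall_fin_two]

theorem totalDegree_aeval_le {R σ τ : Type*} [CommSemiring R] (f : σ → MvPolynomial τ R) (n : ℕ)
    (hf : ∀ i, (f i).totalDegree ≤ n) (p : MvPolynomial σ R) :
    (aeval f p).totalDegree ≤ p.totalDegree * n := by
  rw [aeval_def, eval₂_eq]
  refine totalDegree_finsetSum_le fun m hm => ?_
  refine (totalDegree_mul _ _).trans ?_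
  rw [algebraMap_eq, totalDegree_C, zero_add]
  refine (totalDegree_finsetProd _ _).trans ?_
  calc ∑ i ∈ m.support, (f i ^ m i).totalDegree
      ≤ ∑ i ∈ m.support, m i * n := Finset.sum_le_sum fun i _ =>
        (totalDegree_pow _ _).trans (Nat.mul_le_mul_left _ (hf i))
    _ = (m.sum fun _ e => e) * n := by rw [Finsupp.sum, Finset.sum_mul]
    _ ≤ p.totalDegree * n := Nat.mul_le_mul_right _ (le_totalDegree hm)

theorem degree_mul_le (θ η : PlaneAut K) : (θ * η).degree ≤ θ.degree * η.degree := by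
  rw [degree_le_iff]
  intro i
  rw [component_mul]
  exact (totalDegree_aeval_le _ _ (totalDegree_component_le η) _).trans
    (Nat.mul_le_mul_right _ (totalDegree_component_le θ i))

theorem mul_mem_affineSet {α β : PlaneAut K} (hα : α ∈ affineSet K) (hβ : β ∈ affineSet K) :
    α * β ∈ affineSet K :=
  (degree_mul_le α β).trans (Nat.mul_le_mul hα hβ)

theorem totalDegree_C_mul_X_le {σ : Type*} (a : K) (i : σ) :
    (C a * X i : MvPolynomial σ K).totalDegree ≤ 1 :=
  (totalDegree_mul _ _).trans (by simp)

theorem shear_mem_affineSet (s : K) : shear s ∈ affineSet K := by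
  refine max_le (?_ : _ ≤ 1) (?_ : _ ≤ 1)
  · rw [component_zero_shear, totalDegree_X]
  rw [component_one_shear]
  exact (totalDegree_add _ _).trans (max_le (by simp) (totalDegree_C_mul_X_le _ _))

theorem swap_mem_affineSet : swap K ∈ affineSet K := by
  refine max_le (?_ : _ ≤ 1) (?_ : _ ≤ 1)
  · rw [component_zero_swap, totalDegree_X]
  · rw [component_one_swap, totalDegree_X]

theorem totalDegree_polynomial_aeval_X_le {σ : Type*} (i : σ) (P : Polynomial K) :
    (Polynomial.aeval (X i : MvPolynomial σ K) P).totalDegree ≤ P.natDegree := by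
  rw [Polynomial.aeval_eq_sum_range]
  refine totalDegree_finsetSum_le fun n hn => ?_
  refine (totalDegree_smul_le _ _).trans ?_
  rw [totalDegree_X_pow]
  exact Nat.lt_succ_iff.1 (Finset.mem_range.1 hn)

theorem coeff_polynomial_aeval_X {σ : Type*} (i : σ) (P : Polynomial K) (n : ℕ) :
    (Polynomial.aeval (X i : MvPolynomial σ K) P).coeff (Finsupp.single i n) = P.coeff n := by
  classical
  induction P using Polynomial.induction_on' with
  | add p q hp hq => simp [hp, hq]
  | monomial k a =>
    rw [Polynomial.aeval_monomial, algebraMap_eq, coeff_C_mul, coeff_X_pow, Polynomial.coeff_monomial]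
    by_cases h : k = n
    · simp [h]
    · have : Finsupp.single i k ≠ Finsupp.single i n := fun h' => h (Finsupp.single_injective i h')
      simp [h, this]

theorem degree_le_of_component_eq {τ : PlaneAut K} {a b c : K} {P : Polynomial K}
    (h0 : τ.component 0 = C a * X 0 + Polynomial.aeval (X 1) P)
    (h1 : τ.component 1 = C b * X 1 + C c) : τ.degree ≤ max 1 P.natDegree := by
  refine max_le ?_ ?_
  · rw [h0]
    exact (totalDegree_add _ _).trans
      (max_le_max (totalDegree_C_mul_X_le _ _) (totalDegree_polynomial_aeval_X_le _ _))
  · rw [h1]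
    refine (totalDegree_add _ _).trans (max_le ?_ (by simp))
    exact (totalDegree_C_mul_X_le _ _).trans (le_max_left _ _)

theorem natDegree_le_degree_of_component_eq {τ : PlaneAut K} {a : K} {P : Polynomial K}
    (h0 : τ.component 0 = C a * X 0 + Polynomial.aeval (X 1) P) : P.natDegree ≤ τ.degree := by
  classical
  by_cases hP : P = 0
  · simp [hP]
  refine le_trans ?_ (totalDegree_component_le τ 0)
  have hne : (Finsupp.single (0 : Fin 2) 1) ≠ Finsupp.single 1 P.natDegree := by
    intro h
    simpa using DFunLike.congr_fun h 0
  have hc : (τ.component 0).coeff (Finsupp.single 1 P.natDegree) = P.leadingCoeff := by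
    rw [h0, coeff_add, coeff_polynomial_aeval_X, coeff_C_mul, coeff_X, if_neg hne]
    simp
  have hmem : Finsupp.single 1 P.natDegree ∈ (τ.component 0).support := by
    rw [mem_support_iff, hc]
    simpa using hP
  simpa using le_totalDegree hmem

theorem degree_triangular (a b c : K) (P : Polynomial K) (ha : a ≠ 0) (hb : b ≠ 0)
    (hP : 1 ≤ P.natDegree) : (triangular a b c P ha hb).degree = P.natDegree :=
  le_antisymm ((degree_le_of_component_eq (component_zero_triangular a b c P ha hb)
      (component_one_triangular a b c P ha hb)).trans (by simp [hP]))
    (natDegree_le_degree_of_component_eq (component_zero_triangular a b c P ha hb))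

theorem triangular_zero_mem_affineSet (a b c : K) (ha : a ≠ 0) (hb : b ≠ 0) :
    triangular a b c 0 ha hb ∈ affineSet K :=
  (degree_le_of_component_eq (component_zero_triangular a b c 0 ha hb)
      (component_one_triangular a b c 0 ha hb)).trans (by simp)

theorem triangular_mem_diff (a b c : K) (P : Polynomial K) (ha : a ≠ 0) (hb : b ≠ 0)
    (hP : 2 ≤ P.natDegree) : triangular a b c P ha hb ∈ triangularSet K \ affineSet K := by
  refine ⟨triangular_mem_triangularSet a b c P ha hb, fun h => ?_⟩
  have h' : (triangular a b c P ha hb).degree ≤ 1 := h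
  rw [degree_triangular a b c P ha hb (by omega)] at h'
  omega

/-- Serves as the test for non-triangularity: a nonzero coefficient of `X` in the second component
suffices. -/
theorem coeff_component_one_of_mem_triangularSet {θ : PlaneAut K} (h : θ ∈ triangularSet K) :
    (θ.component 1).coeff (Finsupp.single 0 1) = 0 := by
  classical
  obtain ⟨a, b, c, P, -, -, -, h1⟩ := h
  rw [h1, coeff_add, coeff_C_mul, coeff_X, coeff_C, if_neg, if_neg]
  · simp
  · intro h
    simpa using DFunLike.congr_fun h 0
  · intro h
    simpa using DFunLike.congr_fun h 0

/-- The linear part of an affine automorphism depends on `X`. -/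
theorem exists_coeff_ne_zero_of_mem_affineSet {α : PlaneAut K} (hα : α ∈ affineSet K) :
    ∃ i, (α.component i).coeff (Finsupp.single 0 1) ≠ 0 := by
  by_contra! h
  have hα' : α.degree ≤ 1 := hα
  -- If neither component involved `X`, the substitution `X ↦ 0` would fix both, hence everything
  -- they generate, including `X` itself.
  let φ : MvPolynomial (Fin 2) K →ₐ[K] MvPolynomial (Fin 2) K := aeval ![0, X 1]
  have hφ : ∀ i, φ (α.component i) = α.component i := by
    intro i
    have hsum : φ (α.component i) = ∑ m ∈ (α.component i).support,
        φ (monomial m ((α.component i).coeff m)) := by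
      conv_lhs => rw [(α.component i).as_sum, map_sum]
    rw [hsum]
    conv_rhs => rw [(α.component i).as_sum]
    refine Finset.sum_congr rfl fun m hm => ?_
    have hm1 : m.degree ≤ 1 := (by
      have := (le_totalDegree hm).trans ((totalDegree_component_le α i).trans hα')
      exact this)
    have hm0 : m 0 = 0 := by
      by_contra h0
      have hms : m = Finsupp.single 0 1 := by
        rw [Finsupp.degree_eq_sum, Fin.sum_univ_two] at hm1
        ext j
        fin_cases j
        · simp; omega
        · simp; omega
      exact mem_support_iff.1 hm (hms ▸ h i)
    simp [φ, monomial_eq, Finsupp.prod_fintype, hm0, algebraMap_eq]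
  have hX : (aeval α.component (α⁻¹.component 0) : MvPolynomial (Fin 2) K) = X 0 := by
    rw [← component_mul, inv_mul_cancel, component_one]
  have hcomp : φ.comp (aeval α.component) = aeval α.component :=
    MvPolynomial.algHom_ext fun i => by simpa using hφ i
  have h0 := DFunLike.congr_fun hcomp (α⁻¹.component 0)
  rw [AlgHom.comp_apply, hX] at h0
  simp [φ, eq_comm] at h0

end Degree

/-! ### Zariski closures and one-parameter families. -/

section Closure

variable {K : Type*} [Field K]

/-- Expanding products shows that the coefficients of a composite depend polynomially on those of
the inner map; this is what pulls equations back in `continuous_mul_left`. -/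
theorem exists_eval_coeffs_eq_coeff_aeval (p : MvPolynomial (Fin 2) K) (m : Fin 2 →₀ ℕ) :
    ∃ q : MvPolynomial (Fin 2 × (Fin 2 →₀ ℕ)) K, ∀ θ : PlaneAut K,
      eval θ.coeffs q = (aeval θ.component p).coeff m := by
  classical
  induction p using MvPolynomial.induction_on generalizing m with
  | C a =>
    refine ⟨C (coeff m (C a : MvPolynomial (Fin 2) K)), fun θ => ?_⟩
    rw [eval_C, aeval_C, algebraMap_eq]
  | add p q hp hq =>
    obtain ⟨p', hp'⟩ := hp m
    obtain ⟨q', hq'⟩ := hq m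
    exact ⟨p' + q', fun θ => by simp [hp', hq']⟩
  | mul_X p i hp =>
    choose p' hp' using hp
    refine ⟨∑ x ∈ Finset.HasAntidiagonal.antidiagonal m, p' x.1 * X (i, x.2), fun θ => ?_⟩
    rw [map_mul, aeval_X, coeff_mul, map_sum]
    exact Finset.sum_congr rfl fun x _ => by simp [hp', coeffs]

theorem continuous_mul_left (g : PlaneAut K) : Continuous fun θ : PlaneAut K => g * θ := by
  refine continuous_iff_isClosed.2 fun F hF => ?_
  rw [isClosed_iff] at hF ⊢
  choose q hq using fun x : Fin 2 × (Fin 2 →₀ ℕ) =>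
    exists_eval_coeffs_eq_coeff_aeval (g.component x.1) x.2
  intro n
  obtain ⟨S, hS⟩ := hF (g.degree * n)
  refine ⟨(fun p => bind₁ q p) '' S, fun θ hθ => ?_⟩
  have hc : ∀ p, eval θ.coeffs (bind₁ q p) = eval (g * θ).coeffs p := by
    intro p
    rw [← aeval_eq_eval, ← aeval_eq_eval, aeval_bind₁]
    congr 2
    funext x
    rw [aeval_eq_eval, hq, coeffs, component_mul]
  rw [Set.mem_preimage, hS _ ((degree_mul_le g θ).trans (Nat.mul_le_mul_left _ hθ))]
  simp [hc]

/-- A closed set containing infinitely many members of a polynomial family of automorphisms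
contains every member of the family. -/
theorem mem_of_infinite_family {F : Set (PlaneAut K)} (hF : IsClosed F)
    (Φ : Fin 2 → MvPolynomial (Fin 2) (Polynomial K)) {A : Set K} (hA : A.Infinite)
    (hΦ : ∀ s ∈ A, ∃ θ ∈ F, ∀ i, θ.component i = map (Polynomial.evalRingHom s) (Φ i))
    {s₀ : K} {θ₀ : PlaneAut K}
    (hθ₀ : ∀ i, θ₀.component i = map (Polynomial.evalRingHom s₀) (Φ i)) : θ₀ ∈ F := by
  rw [isClosed_iff] at hF
  -- Closedness is only tested in bounded degree, and specialising the parameter cannot raise the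
  -- degree, so one bound serves the whole family.
  obtain ⟨S, hS⟩ := hF (max (Φ 0).totalDegree (Φ 1).totalDegree)
  have hdeg : ∀ (s : K) (θ : PlaneAut K),
      (∀ i, θ.component i = map (Polynomial.evalRingHom s) (Φ i)) →
      θ.degree ≤ max (Φ 0).totalDegree (Φ 1).totalDegree := fun s θ h => by
    rw [degree, h, h]
    exact max_le_max (Finset.sup_mono (support_map_subset _ _))
      (Finset.sup_mono (support_map_subset _ _))
  have hev : ∀ (p : MvPolynomial (Fin 2 × (Fin 2 →₀ ℕ)) K) (s : K) (θ : PlaneAut K),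
      (∀ i, θ.component i = map (Polynomial.evalRingHom s) (Φ i)) →
      eval θ.coeffs p = (aeval (fun x => coeff x.2 (Φ x.1)) p : Polynomial K).eval s := by
    intro p s θ h
    rw [← Polynomial.coe_aeval_eq_eval, ← AlgHom.comp_apply, comp_aeval, ← aeval_eq_eval]
    congr 2
    funext x
    rw [coeffs, h, coeff_map]
    simp
  refine (hS θ₀ (hdeg s₀ θ₀ hθ₀)).2 fun p hp => ?_
  -- Along the family each equation becomes a one-variable polynomial in the parameter, with
  -- infinitely many roots.
  have h0 : (aeval (fun x => coeff x.2 (Φ x.1)) p : Polynomial K) = 0 := by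
    refine Polynomial.eq_zero_of_infinite_isRoot _ (hA.mono fun s hs => ?_)
    obtain ⟨θ, hθF, hθ⟩ := hΦ s hs
    rw [Set.mem_ofPred_eq, Polynomial.IsRoot, ← hev p s θ hθ]
    exact (hS θ (hdeg s θ hθ)).1 hθF p hp
  rw [hev p s₀ θ₀ hθ₀, h0, Polynomial.eval_zero]

/-- The variant of `mem_of_infinite_family` for families multiplied by an automorphism on the
right. -/
theorem mul_mem_of_infinite_family {F : Set (PlaneAut K)} (hF : IsClosed F)
    (Φ : Fin 2 → MvPolynomial (Fin 2) (Polynomial K)) {A : Set K} (hA : A.Infinite)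
    (β : PlaneAut K)
    (hΦ : ∀ s ∈ A, ∃ θ, θ * β ∈ F ∧ ∀ i, θ.component i = map (Polynomial.evalRingHom s) (Φ i))
    {s₀ : K} {θ₀ : PlaneAut K}
    (hθ₀ : ∀ i, θ₀.component i = map (Polynomial.evalRingHom s₀) (Φ i)) : θ₀ * β ∈ F := by
  have key : ∀ (s : K) (θ : PlaneAut K),
      (∀ i, θ.component i = map (Polynomial.evalRingHom s) (Φ i)) → ∀ i, (θ * β).component i =
        map (Polynomial.evalRingHom s)
          (bind₁ (fun j => map (Polynomial.C : K →+* Polynomial K) (β.component j)) (Φ i)) := by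
    intro s θ h i
    rw [component_mul, h, map_bind₁, aeval_eq_bind₁]
    congr 2
    funext j
    rw [map_map]
    have : (Polynomial.evalRingHom s).comp (Polynomial.C : K →+* Polynomial K) = RingHom.id K := by
      ext; simp
    rw [this, map_id]
  refine mem_of_infinite_family hF _ hA (fun s hs => ?_) (key s₀ θ₀ hθ₀)
  obtain ⟨θ, hθF, hθ⟩ := hΦ s hs
  exact ⟨θ * β, hθF, key s θ hθ⟩

end Closure

/-! ### Prepending a factor to a polydegree. -/

section Strata

variable {K : Type*} [Field K]

theorem mem_polydegreeStratum_singleton {d : ℕ} {θ : PlaneAut K} :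
    θ ∈ polydegreeStratum K [d] ↔ ∃ α τ β : PlaneAut K, α ∈ affineSet K ∧ β ∈ affineSet K ∧
      τ ∈ triangularSet K \ affineSet K ∧ τ.degree = d ∧ θ = α * τ * β := by
  constructor
  · rintro ⟨α, τ, hα, hτ, hd, -, rfl⟩
    refine ⟨α 0, τ 0, α 1, hα 0, hα 1, hτ 0, hd 0, ?_⟩
    simp [List.ofFn_succ, mul_assoc]
  · rintro ⟨α, τ, β, hα, hβ, hτ, hd, rfl⟩
    refine ⟨![α, β], ![τ], ?_, ?_, ?_, ?_, ?_⟩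
    · intro i
      fin_cases i
      · exact hα
      · exact hβ
    · intro i
      fin_cases i
      exact hτ
    · intro i
      fin_cases i
      exact hd
    · intro i h0 h1
      fin_cases i
      · exact (h0 rfl).elim
      · exact (h1 rfl).elim
    · simp [List.ofFn_succ, mul_assoc]

/-- The coefficient of `X` in the second component of `shear s * α` is affine in `s` and not
identically zero, so it vanishes for at most one `s`. If the first component has no `X`, the
quotient defining `s₀` is `0` by convention and no value is actually exceptional. -/
theorem shear_mul_notMem_triangularSet {α : PlaneAut K} (hα : α ∈ affineSet K) :
    ∃ s₀, ∀ s ≠ s₀, shear s * α ∉ triangularSet K := by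
  refine ⟨-((α.component 1).coeff (Finsupp.single 0 1)) /
    (α.component 0).coeff (Finsupp.single 0 1), fun s hs h => ?_⟩
  have h1 := coeff_component_one_of_mem_triangularSet h
  rw [component_mul, component_one_shear, map_add, map_mul, aeval_X, aeval_X, aeval_C,
    algebraMap_eq, coeff_add, coeff_C_mul] at h1
  by_cases h0 : (α.component 0).coeff (Finsupp.single 0 1) = 0
  · obtain ⟨i, hi⟩ := exists_coeff_ne_zero_of_mem_affineSet hα
    fin_cases i
    · exact hi h0
    · rw [h0, mul_zero, add_zero] at h1
      exact hi h1
  · refine hs ?_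
    rw [eq_div_iff h0]
    linear_combination h1

/-- Without the shear, the affine factor between `τ` and the first triangular factor of `η` might be
triangular and the factorization not reduced; a generic shear repairs this. -/
theorem mul_mul_shear_mul_mem_polydegreeStratum {d e : ℕ} {ds : List ℕ} {β τ η : PlaneAut K}
    (hβ : β ∈ affineSet K) (hτ : τ ∈ triangularSet K \ affineSet K) (hd : τ.degree = d)
    (hη : η ∈ polydegreeStratum K (e :: ds)) :
    ∃ s₀, ∀ s ≠ s₀, β * τ * (shear s * η) ∈ polydegreeStratum K (d :: e :: ds) := by
  obtain ⟨α, σ, hα, hσ, hσd, hαt, rfl⟩ := hη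
  obtain ⟨s₀, hs₀⟩ := shear_mul_notMem_triangularSet (hα 0)
  refine ⟨s₀, fun s hs => ⟨Fin.cons β (Fin.cons (shear s * α 0) fun i => α i.succ),
    Fin.cons τ σ, ?_, ?_, ?_, ?_, ?_⟩⟩
  · refine Fin.cases hβ (Fin.cases ?_ fun i => ?_)
    · exact mul_mem_affineSet (shear_mem_affineSet s) (hα 0)
    · exact hα i.succ
  · exact Fin.cases hτ hσ
  · exact Fin.cases hd hσd
  · refine Fin.cases (fun h => (h rfl).elim) (Fin.cases (fun _ _ => ?_) fun i _ hi => ?_)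
    · exact hs₀ s hs
    · refine hαt i.succ (Fin.succ_ne_zero i) fun h => hi ?_
      rw [h]
      rfl
  · simp only [List.length_cons]
    rw [List.ofFn_succ]
    simp [List.ofFn_succ, mul_assoc]

/-- Multiplying on the left by `β τ`, with `β` affine and `τ` triangular of degree `d`, prepends `d`
to the polydegree, up to closure. -/
theorem mul_mul_mem_closure_polydegreeStratum [Infinite K] {d e : ℕ} {ds : List ℕ}
    {β τ η : PlaneAut K} (hβ : β ∈ affineSet K) (hτ : τ ∈ triangularSet K \ affineSet K)
    (hd : τ.degree = d) (hη : η ∈ closure (polydegreeStratum K (e :: ds))) :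
    β * τ * η ∈ closure (polydegreeStratum K (d :: e :: ds)) := by
  have hF := isClosed_closure (X := PlaneAut K) (s := polydegreeStratum K (d :: e :: ds))
  have hF' := hF.preimage (continuous_mul_left (β * τ))
  -- By continuity of left multiplication it is enough to treat `η` in the stratum itself, where the
  -- shear parameter can tend to `0`.
  have hsub : polydegreeStratum K (e :: ds) ⊆
      (fun θ => β * τ * θ) ⁻¹' closure (polydegreeStratum K (d :: e :: ds)) := by
    intro η hη
    obtain ⟨s₀, hs₀⟩ := mul_mul_shear_mul_mem_polydegreeStratum hβ hτ hd hη
    rw [← one_mul η]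
    refine mul_mem_of_infinite_family hF' ![X 0, X 1 + C Polynomial.X * X 0]
      (Set.finite_singleton s₀).infinite_compl η (fun s hs => ⟨shear s, ?_, ?_⟩) (s₀ := 0) ?_
    · exact Set.mem_preimage.2 (subset_closure (hs₀ s (by simpa using hs)))
    · intro i
      fin_cases i <;> simp
    · intro i
      fin_cases i <;> simp
  exact Set.mem_preimage.1 (closure_minimal hsub hF' hη)

end Strata

/-! ### The truncated Catalan series. -/

section CatalanPolynomial

/-- The truncation `∑_{n < m} C_n X ^ n` of the generating function of the Catalan numbers. -/
def catalanPolynomial (R : Type*) [CommRing R] (m : ℕ) : Polynomial R :=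
  ∑ n ∈ Finset.range m, Polynomial.C (catalan n : R) * Polynomial.X ^ n

theorem coeff_catalanPolynomial {R : Type*} [CommRing R] (m n : ℕ) :
    (catalanPolynomial R m).coeff n = if n < m then (catalan n : R) else 0 := by
  simp [catalanPolynomial, Polynomial.finsetSum_coeff, Polynomial.coeff_X_pow]

/-- Below order `m` the truncation is invisible, so this is the Catalan convolution recursion. -/
theorem coeff_catalanPolynomial_sq {R : Type*} [CommRing R] {m n : ℕ} (hn : n < m) :
    (catalanPolynomial R m ^ 2).coeff n = (catalan (n + 1) : R) := by
  rw [sq, Polynomial.coeff_mul, catalan_succ', Nat.cast_sum]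
  refine Finset.sum_congr rfl fun x hx => ?_
  have hx' := Finset.HasAntidiagonal.mem_antidiagonal.1 hx
  rw [coeff_catalanPolynomial, coeff_catalanPolynomial, if_pos (by omega), if_pos (by omega),
    Nat.cast_mul]

/-- The truncated Catalan series satisfies `V = 1 + X V ^ 2` to order `m`. -/
theorem exists_catalanPolynomial_eq (R : Type*) [CommRing R] {m : ℕ} (hm : 1 ≤ m) :
    ∃ E : Polynomial R, E.coeff 0 = (catalan m : R) ∧
      catalanPolynomial R m - Polynomial.X * catalanPolynomial R m ^ 2 =
        1 - Polynomial.X ^ m * E := by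
  have hdvd : Polynomial.X ^ m ∣
      1 + Polynomial.X * catalanPolynomial R m ^ 2 - catalanPolynomial R m := by
    rw [Polynomial.X_pow_dvd_iff]
    intro n hn
    rw [Polynomial.coeff_sub, Polynomial.coeff_add, coeff_catalanPolynomial, if_pos hn]
    cases n with
    | zero => simp
    | succ n =>
      rw [Polynomial.coeff_X_mul, coeff_catalanPolynomial_sq (by omega), Polynomial.coeff_one]
      simp
  obtain ⟨E, hE⟩ := hdvd
  refine ⟨E, ?_, by linear_combination -hE⟩
  -- `E(0)` is read off in degree `m`, where the truncated series itself contributes nothing and `X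
  -- V ^ 2` contributes `catalan m`.
  have h : (Polynomial.X ^ m * E).coeff m = E.coeff 0 := by
    simpa using Polynomial.coeff_X_pow_mul E m 0
  rw [← h, ← hE, Polynomial.coeff_sub, Polynomial.coeff_add, coeff_catalanPolynomial,
    if_neg (lt_irrefl m)]
  obtain ⟨k, rfl⟩ : ∃ k, m = k + 1 := ⟨m - 1, by omega⟩
  rw [Polynomial.coeff_X_mul, coeff_catalanPolynomial_sq (by omega), Polynomial.coeff_one]
  simp

theorem catalan_pos (n : ℕ) : 0 < catalan n := by
  have h := succ_mul_catalan_eq_centralBinom n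
  have h' := Nat.centralBinom_pos n
  rw [← h] at h'
  exact Nat.pos_of_mul_pos_left h'

end CatalanPolynomial

/-! ### The degenerating family. -/

section Degeneration

variable {K : Type*} [Field K]

/-- The polynomial `h⁻ᵐ (Y V(h Y) - Y) + T(Y)`, with `V` the truncated Catalan series. -/
def innerPolynomial (m : ℕ) (T : Polynomial K) (h : K) : Polynomial K :=
  Polynomial.C (h ^ m)⁻¹ *
    (Polynomial.X * (catalanPolynomial K m).comp (Polynomial.C h * Polynomial.X) - Polynomial.X) + T

/-- The coefficient of `Y ^ m` is `h⁻¹ (C_{m-1} + h T_m)`, where `T_m = T.coeff m`. -/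
theorem natDegree_innerPolynomial {m : ℕ} (hm : 2 ≤ m) {T : Polynomial K} (hT : T.natDegree ≤ m)
    {h : K} (hh : h ≠ 0) (hne : (catalan (m - 1) : K) + h * T.coeff m ≠ 0) :
    (innerPolynomial m T h).natDegree = m := by
  have hV : (catalanPolynomial K m).natDegree ≤ m - 1 := by
    rw [Polynomial.natDegree_le_iff_coeff_eq_zero]
    intro n hn
    rw [coeff_catalanPolynomial, if_neg (by omega)]
  have hVc : ((catalanPolynomial K m).comp (Polynomial.C h * Polynomial.X)).natDegree ≤ m - 1 := by
    refine Polynomial.natDegree_comp_le.trans ?_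
    rw [Polynomial.natDegree_C_mul_X h hh, mul_one]
    exact hV
  refine Polynomial.natDegree_eq_of_le_of_coeff_ne_zero ?_ ?_
  · refine Polynomial.natDegree_add_le_of_degree_le ?_ hT
    refine (Polynomial.natDegree_C_mul_le _ _).trans ?_
    refine (Polynomial.natDegree_sub_le _ _).trans (max_le ?_ ?_)
    · refine Polynomial.natDegree_mul_le.trans ?_
      rw [Polynomial.natDegree_X]
      omega
    · rw [Polynomial.natDegree_X]
      omega
  · obtain ⟨k, rfl⟩ : ∃ k, m = k + 2 := ⟨m - 2, by omega⟩
    intro h0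
    refine hne ?_
    rw [innerPolynomial, Polynomial.coeff_add, Polynomial.coeff_C_mul, Polynomial.coeff_sub,
      Polynomial.coeff_X_mul, Polynomial.comp_C_mul_X_coeff, coeff_catalanPolynomial,
      if_pos (by omega), Polynomial.coeff_X, if_neg (by omega)] at h0
    field_simp at h0
    rw [show k + 2 - 1 = k + 1 from rfl]
    refine (mul_eq_zero.1 ?_).resolve_left (pow_ne_zero (k + 1) hh)
    linear_combination h0

/-- The components, over `K[h]`, of a family of automorphisms which degenerates at `h = 0` to
`(X + T(Y) - E(0) Y ^ (m + 1), Y)`. -/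
def degeneration (m : ℕ) (T E : Polynomial K) :
    Fin 2 → MvPolynomial (Fin 2) (Polynomial K) :=
  let H : MvPolynomial (Fin 2) (Polynomial K) := C Polynomial.X
  let A := X 0 + Polynomial.aeval (X 1) T
  let W := X 1 * Polynomial.aeval (H * X 1) (catalanPolynomial K m)
  ![A - X 1 ^ (m + 1) * Polynomial.aeval (H * X 1) E - 2 * H * W * A - H ^ (m + 1) * A ^ 2,
    W + H ^ m * A]

theorem map_polynomial_aeval (s : K) (q : MvPolynomial (Fin 2) (Polynomial K)) (P : Polynomial K) :
    map (Polynomial.evalRingHom s) (Polynomial.aeval q P) =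
      Polynomial.aeval (map (Polynomial.evalRingHom s) q) P := by
  rw [Polynomial.aeval_def, Polynomial.aeval_def, Polynomial.hom_eval₂]
  congr 1
  ext a
  rw [RingHom.comp_apply, IsScalarTower.algebraMap_apply K (Polynomial K), algebraMap_eq,
    map_C, algebraMap_eq]
  simp

theorem map_degeneration_zero (s : K) (m : ℕ) (T E : Polynomial K) :
    map (Polynomial.evalRingHom s) (degeneration m T E 0) =
      X 0 + Polynomial.aeval (X 1) T - X 1 ^ (m + 1) * Polynomial.aeval (C s * X 1) E -
        2 * C s * (X 1 * Polynomial.aeval (C s * X 1) (catalanPolynomial K m)) *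
          (X 0 + Polynomial.aeval (X 1) T) -
        C s ^ (m + 1) * (X 0 + Polynomial.aeval (X 1) T) ^ 2 := by
  simp [degeneration, map_polynomial_aeval]

theorem map_degeneration_one (s : K) (m : ℕ) (T E : Polynomial K) :
    map (Polynomial.evalRingHom s) (degeneration m T E 1) =
      X 1 * Polynomial.aeval (C s * X 1) (catalanPolynomial K m) +
        C s ^ m * (X 0 + Polynomial.aeval (X 1) T) := by
  simp [degeneration, map_polynomial_aeval]

/-- The shear by `s ^ m` cancels the pole of the inner polynomial in the second component; the
functional equation `hE`, evaluated at `s Y`, cancels those in the first. -/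
theorem component_triangular_mul_shear_mul_triangular {m : ℕ} {T E : Polynomial K}
    (hE : catalanPolynomial K m - Polynomial.X * catalanPolynomial K m ^ 2 =
      1 - Polynomial.X ^ m * E) {s : K} (hs : s ≠ 0) (i : Fin 2) :
    (triangular 1 1 0 (Polynomial.C (-(s * (s ^ m)⁻¹)) * Polynomial.X ^ 2) one_ne_zero one_ne_zero *
      (shear (s ^ m) * triangular 1 1 0 (innerPolynomial m T s) one_ne_zero one_ne_zero)).component
        i = map (Polynomial.evalRingHom s) (degeneration m T E i) := by
  have hE' := congrArg (Polynomial.aeval (C s * X 1 : MvPolynomial (Fin 2) K)) hE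
  simp only [map_sub, map_mul, map_pow, map_one, Polynomial.aeval_X] at hE'
  have hinv : (C (s ^ m)⁻¹ * C s ^ m : MvPolynomial (Fin 2) K) = 1 := by
    rw [← C_pow, ← C_mul, inv_mul_cancel₀ (pow_ne_zero m hs), C_1]
  have hQ : Polynomial.aeval (X 1 : MvPolynomial (Fin 2) K) (innerPolynomial m T s) =
      C (s ^ m)⁻¹ * (X 1 * Polynomial.aeval (C s * X 1) (catalanPolynomial K m) - X 1) +
        Polynomial.aeval (X 1) T := by
    simp [innerPolynomial, Polynomial.aeval_comp, algebraMap_eq]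
  fin_cases i
  · change _ = map (Polynomial.evalRingHom s) (degeneration m T E 0)
    rw [map_degeneration_zero]
    simp [component_mul, algebraMap_eq, hQ]
    generalize (Polynomial.aeval (C s * X 1 : MvPolynomial (Fin 2) K)) (catalanPolynomial K m) = V
      at *
    generalize (C (s ^ m)⁻¹ : MvPolynomial (Fin 2) K) = I at *
    generalize (Polynomial.aeval (C s * X 1 : MvPolynomial (Fin 2) K)) E = F at *
    generalize (Polynomial.aeval (X 1 : MvPolynomial (Fin 2) K)) T = U at *
    have hY : X 1 + C s ^ m * (X 0 + (I * (X 1 * V - X 1) + U)) = X 1 * V + C s ^ m * (X 0 + U) := by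
      linear_combination (X 1 * V - X 1) * hinv
    rw [hY]
    linear_combination (-2 * C s * X 1 * V * (X 0 + U) - C s * C s ^ m * (X 0 + U) ^ 2 -
      X 1 ^ (m + 1) * F) * hinv + I * X 1 * hE'
  · change _ = map (Polynomial.evalRingHom s) (degeneration m T E 1)
    rw [map_degeneration_one]
    simp [component_mul, algebraMap_eq, hQ]
    linear_combination (X 1 * Polynomial.aeval (C s * X 1) (catalanPolynomial K m) - X 1) * hinv

end Degeneration

/-! ### The induction on the degree. -/

section Main

variable {K : Type*} [Field K]

/-- If all strata of polydegree `(m)` lie in the closure of the stratum `(e :: ds)`, then a product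
`β (X + P(Y), Y) γ` with `deg P = m + 1` and leading coefficient `-catalan m` lies in the closure of
the stratum `(2 :: e :: ds)`. -/
theorem mul_triangular_mul_mem_closure [CharZero K] {m e : ℕ} {ds : List ℕ} (hm : 2 ≤ m)
    (ih : polydegreeStratum K [m] ⊆ closure (polydegreeStratum K (e :: ds)))
    {β γ : PlaneAut K} (hβ : β ∈ affineSet K) (hγ : γ ∈ affineSet K) {P : Polynomial K}
    (hP : P.natDegree ≤ m + 1) (hPm : P.coeff (m + 1) = -(catalan m : K)) :
    β * (triangular 1 1 0 P one_ne_zero one_ne_zero * γ) ∈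
      closure (polydegreeStratum K (2 :: e :: ds)) := by
  obtain ⟨E, hE0, hE⟩ := exists_catalanPolynomial_eq K (m := m) (by omega)
  -- `T` is `P` with its term of degree `m + 1` removed; the limit of the family restores that term
  -- as `-E(0) Y ^ (m + 1)`.
  let T : Polynomial K := P + Polynomial.C (catalan m : K) * Polynomial.X ^ (m + 1)
  have hT : T.natDegree ≤ m := by
    rw [Polynomial.natDegree_le_iff_coeff_eq_zero]
    intro n hn
    rw [Polynomial.coeff_add, Polynomial.coeff_C_mul, Polynomial.coeff_X_pow]
    by_cases h : n = m + 1
    · rw [h, hPm]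
      simp
    · rw [if_neg h, Polynomial.coeff_eq_zero_of_natDegree_lt (by omega)]
      simp
  have hF := (isClosed_closure (X := PlaneAut K)
    (s := polydegreeStratum K (2 :: e :: ds))).preimage (continuous_mul_left β)
  -- The second excluded value is where the inner polynomial drops in degree; if `T.coeff m = 0` it
  -- is `0` by convention, and there is no further exception.
  have hA : ({0, -(catalan (m - 1) : K) / T.coeff m}ᶜ : Set K).Infinite :=
    (Set.toFinite _).infinite_compl
  refine Set.mem_preimage.1 (mul_mem_of_infinite_family hF (degeneration m T E) hA γ
    (fun s hs => ⟨_, ?_, component_triangular_mul_shear_mul_triangular hE ?_⟩) (s₀ := 0) ?_)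
  · simp only [Set.mem_compl_iff, Set.mem_insert_iff, Set.mem_singleton_iff, not_or] at hs
    have hne : (catalan (m - 1) : K) + s * T.coeff m ≠ 0 := by
      intro h
      have hc : (catalan (m - 1) : K) ≠ 0 := Nat.cast_ne_zero.2 (catalan_pos _).ne'
      have ht : T.coeff m ≠ 0 := by
        intro ht
        rw [ht, mul_zero, add_zero] at h
        exact hc h
      refine hs.2 ?_
      rw [eq_div_iff ht]
      linear_combination h
    have hd := natDegree_innerPolynomial hm hT hs.1 hne
    have h2 : (Polynomial.C (-(s * (s ^ m)⁻¹)) * Polynomial.X ^ 2 : Polynomial K).natDegree = 2 :=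
      Polynomial.natDegree_C_mul_X_pow _ _
        (neg_ne_zero.2 (mul_ne_zero hs.1 (inv_ne_zero (pow_ne_zero m hs.1))))
    -- Regrouped as `β` times the quadratic map, followed by an element of polydegree `(m)` to which
    -- `ih` applies.
    rw [Set.mem_preimage, mul_assoc, ← mul_assoc β]
    refine mul_mul_mem_closure_polydegreeStratum hβ
      (triangular_mem_diff _ _ _ _ _ _ h2.ge) ?_ (ih ?_)
    · rw [degree_triangular _ _ _ _ _ _ (by omega), h2]
    · rw [mem_polydegreeStratum_singleton]
      refine ⟨_, _, γ, shear_mem_affineSet (s ^ m), hγ,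
        triangular_mem_diff 1 1 0 _ one_ne_zero one_ne_zero (hm.trans hd.ge), ?_, rfl⟩
      rw [degree_triangular _ _ _ _ _ _ (by omega), hd]
  · simp only [Set.mem_compl_iff, Set.mem_insert_iff, Set.mem_singleton_iff, not_or] at hs
    exact hs.1
  · have h00 : ∀ Q : Polynomial K, Polynomial.aeval (0 : MvPolynomial (Fin 2) K) Q =
        C (Q.coeff 0) := by
      intro Q
      rw [← Polynomial.coeff_zero_eq_aeval_zero', algebraMap_eq]
    refine Fin.forall_fin_two.2 ⟨?_, ?_⟩
    · rw [map_degeneration_zero, component_zero_triangular, C_0, zero_mul, h00, hE0]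
      simp [T]
      ring
    · rw [map_degeneration_one, component_one_triangular, C_0, zero_mul, h00,
        coeff_catalanPolynomial, if_pos (by omega)]
      simp [show m ≠ 0 by omega]

/-- The free parameter `κ` rescales `P` between two affine maps, so its leading coefficient can be
normalised to `-catalan m`. -/
theorem triangular_factorization {τ : PlaneAut K} {a b c : K} {P : Polynomial K} (ha : a ≠ 0)
    (hb : b ≠ 0) (h0 : τ.component 0 = C a * X 0 + Polynomial.aeval (X 1) P)
    (h1 : τ.component 1 = C b * X 1 + C c) {κ : K} (hκ : κ ≠ 0) :
    τ = triangular κ b c 0 hκ hb *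
      (triangular 1 1 0 (Polynomial.C κ⁻¹ * P) one_ne_zero one_ne_zero *
        triangular (κ⁻¹ * a) 1 0 0 (mul_ne_zero (inv_ne_zero hκ) ha) one_ne_zero) := by
  have hinv : (C κ * C κ⁻¹ : MvPolynomial (Fin 2) K) = 1 := by
    rw [← C_mul, mul_inv_cancel₀ hκ, C_1]
  refine ext_component (Fin.forall_fin_two.2 ⟨?_, ?_⟩)
  · have hP : bind₁ (triangular (κ⁻¹ * a) 1 0 0 (mul_ne_zero (inv_ne_zero hκ) ha)
        one_ne_zero).component (Polynomial.aeval (X 1) P) = Polynomial.aeval (X 1) P := by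
      rw [← Polynomial.aeval_algHom_apply]
      simp
    rw [h0]
    simp [component_mul, algebraMap_eq, hP]
    linear_combination -(C a * X 0 + Polynomial.aeval (X 1) P) * hinv
  · rw [h1]
    simp [component_mul, algebraMap_eq]

theorem polydegreeStratum_succ_subset_closure [CharZero K] {m e : ℕ} {ds : List ℕ} (hm : 2 ≤ m)
    (ih : polydegreeStratum K [m] ⊆ closure (polydegreeStratum K (e :: ds))) :
    polydegreeStratum K [m + 1] ⊆ closure (polydegreeStratum K (2 :: e :: ds)) := by
  intro θ hθ
  obtain ⟨α, τ, γ, hα, hγ, ⟨⟨a, b, c, P, ha, hb, h0, h1⟩, -⟩, hd, rfl⟩ :=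
    mem_polydegreeStratum_singleton.1 hθ
  have hP : P.natDegree = m + 1 := by
    refine le_antisymm (hd ▸ natDegree_le_degree_of_component_eq h0) ?_
    -- The alternative `1` in the maximum is excluded because `m + 1 ≥ 3`.
    have := hd ▸ degree_le_of_component_eq h0 h1
    rcases le_max_iff.1 this with h | h <;> omega
  have hlead : P.coeff (m + 1) ≠ 0 := by
    rw [← hP]
    exact Polynomial.leadingCoeff_ne_zero.2 fun h => by simp [h] at hP
  have hc : -(catalan m : K) ≠ 0 := neg_ne_zero.2 (Nat.cast_ne_zero.2 (catalan_pos m).ne')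
  have hκ : P.coeff (m + 1) / -(catalan m : K) ≠ 0 := div_ne_zero hlead hc
  rw [triangular_factorization ha hb h0 h1 hκ]
  have := mul_triangular_mul_mem_closure hm ih
    (mul_mem_affineSet hα (triangular_zero_mem_affineSet _ b c hκ hb))
    (mul_mem_affineSet (triangular_zero_mem_affineSet _ 1 0
      (mul_ne_zero (inv_ne_zero hκ) ha) one_ne_zero) hγ)
    (P := Polynomial.C (P.coeff (m + 1) / -(catalan m : K))⁻¹ * P)
    ((Polynomial.natDegree_C_mul_le _ _).trans hP.le) (by
      rw [Polynomial.coeff_C_mul, inv_div, div_mul_cancel₀ _ hlead])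
  simpa only [mul_assoc] using this

theorem polydegreeStratum_subset_closure_replicate [CharZero K] (k : ℕ) :
    polydegreeStratum K [k + 2] ⊆ closure (polydegreeStratum K (List.replicate (k + 1) 2)) := by
  induction k with
  | zero => exact subset_closure
  | succ k ih =>
    rw [List.replicate_succ] at ih
    rw [List.replicate_succ, List.replicate_succ]
    exact polydegreeStratum_succ_subset_closure (by omega) ih

theorem mem_polydegreeStratum_of_component_eq {d : ℕ} (hd : 2 ≤ d) {θ : PlaneAut K} {a : K}
    (ha : a ≠ 0) (h0 : θ.component 0 = X 0) (h1 : θ.component 1 = X 1 + C a * X 0 ^ d) :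
    θ ∈ polydegreeStratum K [d] := by
  have hdeg := Polynomial.natDegree_C_mul_X_pow d a ha
  refine mem_polydegreeStratum_singleton.2 ⟨swap K,
    triangular 1 1 0 (Polynomial.C a * Polynomial.X ^ d) one_ne_zero one_ne_zero, swap K,
    swap_mem_affineSet, swap_mem_affineSet, triangular_mem_diff _ _ _ _ _ _ (hd.trans hdeg.ge),
    ?_, ext_component (Fin.forall_fin_two.2 ⟨?_, ?_⟩)⟩
  · rw [degree_triangular _ _ _ _ _ _ (by omega), hdeg]
  · rw [h0]
    simp [component_mul]
  · rw [h1]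
    simp [component_mul, algebraMap_eq]

/-- The automorphism `(X, Y + a X ^ d)`. -/
def elementary (d : ℕ) (a : K) : PlaneAut K :=
  ofComponents ![X 0, X 1 + C a * X 0 ^ d] ![X 0, X 1 - C a * X 0 ^ d]
    (by intro i; fin_cases i <;> simp [algebraMap_eq])
    (by intro i; fin_cases i <;> simp [algebraMap_eq])

/-- For `a ≠ 0`, swapping the coordinates makes the map triangular of degree `d`; the identity, `a =
0`, is reached only as a limit. -/
theorem rootSubgroupH_subset_closure [Infinite K] {d : ℕ} (hd : 2 ≤ d) :
    rootSubgroupH K d ⊆ closure (polydegreeStratum K [d]) := by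
  rintro θ ⟨a, h0, h1⟩
  refine mem_of_infinite_family isClosed_closure ![X 0, X 1 + C Polynomial.X * X 0 ^ d]
    (Set.finite_singleton (0 : K)).infinite_compl (fun s hs => ⟨elementary d s, subset_closure
      (mem_polydegreeStratum_of_component_eq hd (a := s) (by simpa using hs)
        (by simp [elementary]) (by simp [elementary])), ?_⟩) (s₀ := a) ?_
  · exact Fin.forall_fin_two.2 ⟨by simp [elementary], by simp [elementary]⟩
  · exact Fin.forall_fin_two.2 ⟨by simp [h0], by simp [h1]⟩

end Main

end PlaneAut

end

theorem mainTheorem10 (d : ℕ) (hd : 2 ≤ d) :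
    PlaneAut.polydegreeStratum ℂ [d] ⊆
        closure (PlaneAut.polydegreeStratum ℂ (List.replicate (d - 1) 2)) ∧
      PlaneAut.rootSubgroupH ℂ d ⊆
        closure (PlaneAut.polydegreeStratum ℂ (List.replicate (d - 1) 2)) := by
  have h : PlaneAut.polydegreeStratum ℂ [d] ⊆
      closure (PlaneAut.polydegreeStratum ℂ (List.replicate (d - 1) 2)) := by
    obtain ⟨k, rfl⟩ : ∃ k, d = k + 2 := ⟨d - 2, by omega⟩
    exact PlaneAut.polydegreeStratum_subset_closure_replicate k
  exact ⟨h, (PlaneAut.rootSubgroupH_subset_closure hd).trans (closure_minimal h isClosed_closure)⟩
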